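/- Let $K$ be a field, fix $n$, a subset $S\subseteq\{x_1,\dots,x_n\}$ with $s=|S|$, $t=n-s$, and a real number $k\in(0,n)$. Let $p=D^{-k}$ and let $\mathcal I\sim\mathcal I(n,D,p)$ be the random monomial ideal of $K[x_1,\dots,x_n]$ generated by a random set of monomials, in which each monomial of degree between $1$ and $D$ is included independently with probability $p$. A pair $(x^\alpha,S)$ is admissible for a monomial ideal $I$ if $\mathrm{supp}(x^\alpha)\cap S=\emptyset$ and no monomial of $x^\alpha\cdot K[S]$ lies in $I$; it is a standard pair of $I$ if it is minimal among all admissible pairs (with any set of variables) for the order $(x^\alpha,S)\le(x^\beta,T)$ iff $x^\alpha\mid x^\beta$ and $\mathrm{supp}(x^{\beta-\alpha})\cup T\subseteq S$. For real $d$ put $Z(t,d)=\#\{\alpha\in\mathbb Z_{\ge0}^t:\prod_{i=1}^t(\alpha_i+1)\le d\}$. "Asymptotically almost surely" (a.a.s.) means with probability tending to $1$ as $D\to\infty$. 1. If $s<k$, there is a constant $C>0$ such that for every $\epsilon>0$, a.a.s. $$C\,Z(t,D^{k-s-\epsilon})<\#\{\text{standard pairs }(x^\alpha,S)\text{ of }\mathcal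 I\}<Z(t,D^{k-s+\epsilon}).$$ 2. If $s=k$, then for every $\epsilon>0$, a.a.s. $\#\{\text{standard pairs }(x^\alpha,S)\text{ of }\mathcal I\}<Z(t,D^{k-s+\epsilon})$. 3. If $s>k$, then a.a.s. $\mathcal I$ has no standard pair of the form $(x^\alpha,S)$. -/

import Mathlib

open Filter Topology

noncomputable section

namespace RandomMonomialIdeal

/-- The exponent vectors of the monomials in `n` variables of positive degree at most `D`. -/
def monomialsUpTo (n D : ℕ) : Finset (Fin n →₀ ℕ) :=
  (Finset.Icc 1 D).biUnion fun d => Finset.univ.finsuppAntidiag d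

theorem mem_monomialsUpTo {n D : ℕ} {α : Fin n →₀ ℕ} :
    α ∈ monomialsUpTo n D ↔ 0 < ∑ i, α i ∧ ∑ i, α i ≤ D := by
  simp [monomialsUpTo, Finset.mem_finsuppAntidiag, Nat.one_le_iff_ne_zero, Nat.pos_iff_ne_zero]

/-- The probability that `B` is the set selected when every monomial of positive degree at most `D`
is selected independently with probability `p`. -/
def genWeight (n D : ℕ) (p : unitInterval) (B : Finset (Fin n →₀ ℕ)) : ENNReal :=
  if B ⊆ monomialsUpTo n D then
    ENNReal.ofReal (p : ℝ) ^ B.card *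
      ENNReal.ofReal (1 - (p : ℝ)) ^ ((monomialsUpTo n D).card - B.card)
  else 0

theorem sum_genWeight (n D : ℕ) (p : unitInterval) :
    ∑ B ∈ (monomialsUpTo n D).powerset, genWeight n D p B = 1 := by
  have h : ∑ B ∈ (monomialsUpTo n D).powerset, genWeight n D p B =
      ∑ B ∈ (monomialsUpTo n D).powerset, ENNReal.ofReal (p : ℝ) ^ B.card *
        ENNReal.ofReal (1 - (p : ℝ)) ^ ((monomialsUpTo n D).card - B.card) :=
    Finset.sum_congr rfl fun B hB => if_pos (Finset.mem_powerset.1 hB)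
  rw [h, Finset.sum_pow_mul_eq_add_pow, ← ENNReal.ofReal_add p.2.1 (sub_nonneg.2 p.2.2)]
  simp

/-- The law of the random generating set: every monomial of positive degree at most `D` is
selected independently with probability `p`. -/
def randomGenerators (n D : ℕ) (p : unitInterval) : PMF (Finset (Fin n →₀ ℕ)) :=
  PMF.ofFinset (genWeight n D p) (monomialsUpTo n D).powerset (sum_genWeight n D p)
    fun _ hB => if_neg fun h => hB (Finset.mem_powerset.2 h)

/-- The ideal of `K[x_1, …, x_n]` generated by the monomials with exponents in `B`. -/
def monomialIdeal (K : Type*) [Field K] {n : ℕ} (B : Finset (Fin n →₀ ℕ)) :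
    Ideal (MvPolynomial (Fin n) K) :=
  Ideal.span ((fun α => MvPolynomial.monomial α (1 : K)) '' (B : Set (Fin n →₀ ℕ)))

/-- The distribution `I(n, D, p)` of the random monomial ideal of `K[x_1, …, x_n]`. -/
def randomIdeal (K : Type*) [Field K] (n D : ℕ) (p : unitInterval) :
    PMF (Ideal (MvPolynomial (Fin n) K)) :=
  (randomGenerators n D p).map (monomialIdeal K)

/-- `(x^α, S)` is an admissible pair of `I`: the support of `x^α` is disjoint from `S`, and every
monomial of `x^α K[S]` is a standard monomial of `I`, that is, lies outside `I`. -/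
def IsAdmissiblePair {K : Type*} [Field K] {n : ℕ} (I : Ideal (MvPolynomial (Fin n) K))
    (α : Fin n →₀ ℕ) (S : Finset (Fin n)) : Prop :=
  Disjoint α.support S ∧
    ∀ γ : Fin n →₀ ℕ, γ.support ⊆ S → MvPolynomial.monomial (α + γ) (1 : K) ∉ I

/-- The partial order on pairs: `(x^α, S) ≤ (x^β, T)` if `x^α` divides `x^β` and
`supp(x^(β-α)) ∪ T ⊆ S`. -/
def PairLE {n : ℕ} (α : Fin n →₀ ℕ) (S : Finset (Fin n)) (β : Fin n →₀ ℕ) (T : Finset (Fin n)) :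
    Prop :=
  α ≤ β ∧ (β - α).support ∪ T ⊆ S

/-- `(x^α, S)` is a standard pair of `I`: a minimal admissible pair. -/
def IsStandardPair {K : Type*} [Field K] {n : ℕ} (I : Ideal (MvPolynomial (Fin n) K))
    (α : Fin n →₀ ℕ) (S : Finset (Fin n)) : Prop :=
  IsAdmissiblePair I α S ∧
    ∀ (β : Fin n →₀ ℕ) (T : Finset (Fin n)),
      IsAdmissiblePair I β T → PairLE β T α S → β = α ∧ T = S

/-- The exponents `α` of the standard pairs `(x^α, S)` of `I`, for a given `S`. -/
def standardPairs {K : Type*} [Field K] {n : ℕ} (I : Ideal (MvPolynomial (Fin n) K))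
    (S : Finset (Fin n)) : Set (Fin n →₀ ℕ) :=
  {α | IsStandardPair I α S}

/-- `Z(t, d)`, the number of `α ∈ ℤ_{≥ 0}^t` with `∏ (α_i + 1) ≤ d`. -/
def Z (t : ℕ) (d : ℝ) : ℕ :=
  {α : Fin t → ℕ | ∏ i, ((α i : ℝ) + 1) ≤ d}.ncard

/-- The set counted by `Z t d` is finite. -/
theorem Z_finite (t : ℕ) (d : ℝ) : {α : Fin t → ℕ | ∏ i, ((α i : ℝ) + 1) ≤ d}.Finite := by
  refine (Set.finite_Iic (fun _ : Fin t => ⌊d⌋₊)).subset fun α hα i => ?_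
  have hα' : ∏ i, ((α i : ℝ) + 1) ≤ d := hα
  refine Nat.le_floor (le_trans ?_ hα')
  rw [← Finset.mul_prod_erase _ _ (Finset.mem_univ i)]
  have h : (1 : ℝ) ≤ ∏ j ∈ Finset.univ.erase i, ((α j : ℝ) + 1) := by
    rw [← Finset.prod_const_one (s := Finset.univ.erase i)]
    exact Finset.prod_le_prod (fun _ _ => zero_le_one) fun j _ => by simp
  nlinarith [(α i).cast_nonneg (α := ℝ)]

/-- The events `E D` hold asymptotically almost surely as `D → ∞` under the laws `P D`. -/
def AAS {X : Type*} (P : ℕ → PMF X) (E : ℕ → Set X) : Prop :=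
  Tendsto (fun D => (P D).toOuterMeasure (E D)) atTop (𝓝 1)

end RandomMonomialIdeal

end

/-!
A pair `(x^α, S)` is admissible for the ideal generated by `B` exactly when no `b ∈ B` satisfies
`b i ≤ α i` for all `i ∉ S`. So it forbids generators in a box with about `D ^ s * ∏ (α i + 1)`
lattice points of degree at most `D`, and as each is selected with probability `D ^ (-k)`, the
threshold is `∏ (α i + 1) ≈ D ^ (k - s)`.

Upper bounds. There are only polynomially many boxes with sides at most `D / n`, and one with more
than `D ^ (k + δ)` points is missed by the generators with probability at most `exp (1 - D ^ δ)`; by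
the union bound all of them are hit (`aas_exists_le_of_le_prod`). In a standard pair the exponents
are less than `D`, because otherwise the variable could be moved to `S`; so truncating `α` at
`D / n` costs only a constant factor, and `∏ (α i + 1)` is at most a constant times
`D ^ (k - s + δ)` (`aas_prod_standardPair_lt`). For `s ≤ k` this bounds the number of standard pairs
by `Z`, and for `s > k` it is absurd.

Lower bound. Take all `α` with exponents between `h` and `2 * h` outside `S`, where
`h ^ t ≈ D ^ (k - s - η)`. All these pairs are admissible, since the lower set they span is one box,
which contains a generator with probability `O(D ^ (-η))`. They are minimal, because `h` is at most
`D ^ a` with `a + η < 1`, so that letting one more variable range up to `D / n` instead of `h`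
produces boxes with more than `D ^ (k + δ)` points, which are hit
(`aas_Icc_subset_standardPairs`). The number of these pairs exceeds `Z t (D ^ (k - s - ε))` by a
power of `D`, since `Z t d = O(d ^ (1 + ρ))` for every `ρ > 0` by Rankin's trick
(`exists_Z_le_mul_rpow`). So the constant `C = 1` serves for every `ε`.
-/

open Filter Topology

noncomputable section

namespace RandomMonomialIdeal

/-! ### Events that hold asymptotically almost surely -/

theorem toOuterMeasure_add_compl {X : Type*} (P : PMF X) (E : Set X) :
    P.toOuterMeasure E + P.toOuterMeasure Eᶜ = 1 := by
  rw [PMF.toOuterMeasure_apply, PMF.toOuterMeasure_apply, ← ENNReal.tsum_add, ← P.tsum_coe]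
  exact tsum_congr fun x => Set.indicator_self_add_compl_apply E P x

theorem aas_iff_compl {X : Type*} {P : ℕ → PMF X} {E : ℕ → Set X} :
    AAS P E ↔ Tendsto (fun D => (P D).toOuterMeasure (E D)ᶜ) atTop (𝓝 0) := by
  have key : ∀ F : ℕ → Set X, (fun D => (P D).toOuterMeasure (F D)ᶜ) =
      fun D => 1 - (P D).toOuterMeasure (F D) := fun F => funext fun D => by
    have h := toOuterMeasure_add_compl (P D) (F D)
    refine ENNReal.eq_sub_of_add_eq ?_ (by rw [add_comm]; exact h)
    exact ne_top_of_le_ne_top ENNReal.one_ne_top (h ▸ le_self_add)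
  constructor
  · intro h
    rw [key E]
    simpa using ENNReal.Tendsto.sub tendsto_const_nhds h (Or.inl ENNReal.one_ne_top)
  · intro h
    have h2 := key fun D => (E D)ᶜ
    simp only [compl_compl] at h2
    unfold AAS
    rw [h2]
    simpa using ENNReal.Tendsto.sub tendsto_const_nhds h (Or.inl ENNReal.one_ne_top)

theorem AAS.mono {X : Type*} {P : ℕ → PMF X} {E F : ℕ → Set X} (hE : AAS P E)
    (h : ∀ᶠ D in atTop, E D ⊆ F D) : AAS P F := by
  rw [aas_iff_compl] at *
  refine tendsto_of_tendsto_of_tendsto_of_le_of_le' tendsto_const_nhds hE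
    (Eventually.of_forall fun _ => zero_le) ?_
  filter_upwards [h] with D hD
  exact MeasureTheory.measure_mono (Set.compl_subset_compl.2 hD)

theorem AAS.inter {X : Type*} {P : ℕ → PMF X} {E F : ℕ → Set X} (hE : AAS P E) (hF : AAS P F) :
    AAS P fun D => E D ∩ F D := by
  rw [aas_iff_compl] at *
  have h := hE.add hF
  rw [add_zero] at h
  refine tendsto_of_tendsto_of_tendsto_of_le_of_le tendsto_const_nhds h
    (fun _ => zero_le) fun D => ?_
  simp only [Set.compl_inter]
  exact MeasureTheory.measure_union_le _ _

theorem aas_map {X Y : Type*} {P : ℕ → PMF X} (f : X → Y) {E : ℕ → Set Y}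
    (h : AAS P fun D => f ⁻¹' E D) : AAS (fun D => (P D).map f) E := by
  simpa only [AAS, PMF.toOuterMeasure_map_apply] using h

/-! ### The law of the random generating set -/

theorem toOuterMeasure_disjoint {n D : ℕ} (p : unitInterval) {F : Finset (Fin n →₀ ℕ)}
    (hF : F ⊆ monomialsUpTo n D) :
    (randomGenerators n D p).toOuterMeasure {B | Disjoint B F} =
      ENNReal.ofReal (1 - (p : ℝ)) ^ F.card := by
  classical
  set U := monomialsUpTo n D
  have hsub : (U \ F).powerset ⊆ U.powerset := Finset.powerset_mono.2 Finset.sdiff_subset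
  have hcard : (U \ F).card + F.card = U.card := Finset.card_sdiff_add_card_eq_card hF
  rw [PMF.toOuterMeasure_apply, tsum_eq_sum (s := (U \ F).powerset)]
  · have h : ∀ B ∈ (U \ F).powerset,
        ({B | Disjoint B F} : Set (Finset (Fin n →₀ ℕ))).indicator (randomGenerators n D p) B =
          ENNReal.ofReal (1 - (p : ℝ)) ^ F.card * (ENNReal.ofReal (p : ℝ) ^ B.card *
            ENNReal.ofReal (1 - (p : ℝ)) ^ ((U \ F).card - B.card)) := by
      intro B hB
      have hB' := Finset.mem_powerset.1 hB
      have hBU := hB'.trans Finset.sdiff_subset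
      have hle := Finset.card_le_card hB'
      rw [Set.indicator_of_mem (s := {B | Disjoint B F})
        (Finset.disjoint_of_subset_left hB' Finset.sdiff_disjoint)]
      change genWeight n D p B = _
      rw [genWeight, if_pos hBU, mul_left_comm, ← pow_add]
      congr 2
      change U.card - _ = _
      omega
    rw [Finset.sum_congr rfl h, ← Finset.mul_sum, Finset.sum_pow_mul_eq_add_pow,
      ← ENNReal.ofReal_add p.2.1 (sub_nonneg.2 p.2.2)]
    simp
  · intro B hB
    by_cases hd : Disjoint B F
    · rw [Set.indicator_of_mem (s := {B | Disjoint B F}) hd]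
      refine if_neg fun hBU => hB (Finset.mem_powerset.2 ?_)
      exact Finset.subset_sdiff.2 ⟨hBU, hd⟩
    · exact Set.indicator_of_notMem (s := {B | Disjoint B F}) hd _

theorem aas_subset_monomialsUpTo {n : ℕ} (p : ℕ → unitInterval) :
    AAS (fun D => randomGenerators n D (p D)) fun D => {B | B ⊆ monomialsUpTo n D} := by
  refine tendsto_const_nhds.congr fun D => ?_
  symm
  rw [PMF.toOuterMeasure_apply_eq_one_iff]
  intro B hB
  by_contra h
  exact (PMF.mem_support_iff _ _).1 hB (if_neg h)

theorem card_Iic_eq_prod {n : ℕ} (c : Fin n →₀ ℕ) : (Finset.Iic c).card = ∏ i, (c i + 1) := by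
  rw [Finsupp.card_Iic]
  simp only [Nat.card_Iic]
  exact Finset.prod_subset (Finset.subset_univ _) fun i _ hi => by
    simp [Finsupp.notMem_support_iff.1 hi]

/-- A box of total degree at most `D` consists of candidates for generators, apart from the
exponent `0`, so it is missed by all generators with probability
`(1 - p) ^ (#box - 1) ≤ exp (1 - p * #box)`. -/
theorem toOuterMeasure_forall_not_le {n D : ℕ} (p : unitInterval) {c : Fin n →₀ ℕ}
    (hc : ∑ i, c i ≤ D) :
    (randomGenerators n D p).toOuterMeasure {B | ∀ b ∈ B, ¬ b ≤ c} ≤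
      ENNReal.ofReal (Real.exp (1 - p * ∏ i, ((c i : ℝ) + 1))) := by
  classical
  have hF : (Finset.Iic c).erase 0 ⊆ monomialsUpTo n D := by
    intro b hb
    rw [Finset.mem_erase, Finset.mem_Iic] at hb
    rw [mem_monomialsUpTo]
    refine ⟨Nat.pos_of_ne_zero fun h => hb.1 ?_, (Finset.sum_le_sum fun i _ => hb.2 i).trans hc⟩
    ext i
    exact Finset.sum_eq_zero_iff.1 h i (Finset.mem_univ i)
  have hcard : ((((Finset.Iic c).erase 0).card : ℕ) : ℝ) = ∏ i, ((c i : ℝ) + 1) - 1 := by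
    rw [Finset.card_erase_of_mem (Finset.mem_Iic.2 (zero_le (a := c))), Nat.cast_sub, card_Iic_eq_prod]
    · push_cast; rfl
    · exact Finset.card_pos.2 ⟨c, by simp⟩
  calc _ ≤ (randomGenerators n D p).toOuterMeasure {B | Disjoint B ((Finset.Iic c).erase 0)} := by
        refine MeasureTheory.measure_mono fun B hB => Finset.disjoint_left.2 fun b hb hb' => ?_
        exact hB b hb (Finset.mem_Iic.1 (Finset.mem_of_mem_erase hb'))
    _ ≤ _ := by
        rw [toOuterMeasure_disjoint p hF, ← ENNReal.ofReal_pow (sub_nonneg.2 p.2.2)]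
        refine ENNReal.ofReal_le_ofReal ?_
        calc (1 - (p : ℝ)) ^ ((Finset.Iic c).erase 0).card
            ≤ Real.exp (-p) ^ ((Finset.Iic c).erase 0).card :=
              pow_le_pow_left₀ (sub_nonneg.2 p.2.2) (Real.one_sub_le_exp_neg _) _
          _ = Real.exp (-p * (∏ i, ((c i : ℝ) + 1) - 1)) := by
              rw [← Real.exp_nat_mul, hcard, mul_comm]
          _ ≤ _ := Real.exp_le_exp.2 (by nlinarith [p.2.2])

/-- The union bound for a generator in a given box, by Bernoulli's inequality. -/
theorem toOuterMeasure_exists_le {n D : ℕ} (p : unitInterval) (c : Fin n →₀ ℕ) :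
    (randomGenerators n D p).toOuterMeasure {B | B ⊆ monomialsUpTo n D ∧ ∃ b ∈ B, b ≤ c} ≤
      ENNReal.ofReal (p * ∏ i, ((c i : ℝ) + 1)) := by
  classical
  set F := (Finset.Iic c) ∩ monomialsUpTo n D
  have hcard : ((F.card : ℕ) : ℝ) ≤ ∏ i, ((c i : ℝ) + 1) := by
    have h : F.card ≤ ∏ i, (c i + 1) :=
      (Finset.card_le_card Finset.inter_subset_left).trans (card_Iic_eq_prod c).le
    exact_mod_cast h
  have hsum := toOuterMeasure_add_compl (randomGenerators n D p) {B | Disjoint B F}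
  rw [toOuterMeasure_disjoint p Finset.inter_subset_right,
    ← ENNReal.ofReal_pow (sub_nonneg.2 p.2.2)] at hsum
  have hq : (randomGenerators n D p).toOuterMeasure {B | Disjoint B F}ᶜ =
      1 - ENNReal.ofReal ((1 - (p : ℝ)) ^ F.card) :=
    ENNReal.eq_sub_of_add_eq ENNReal.ofReal_ne_top (by rw [add_comm]; exact hsum)
  calc _ ≤ (randomGenerators n D p).toOuterMeasure {B | Disjoint B F}ᶜ := by
        refine MeasureTheory.measure_mono ?_
        rintro B ⟨hB, b, hb, hbc⟩ hd
        exact Finset.disjoint_left.1 hd hb (Finset.mem_inter.2 ⟨Finset.mem_Iic.2 hbc, hB hb⟩)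
    _ = ENNReal.ofReal (1 - (1 - (p : ℝ)) ^ F.card) := by
        rw [hq, ENNReal.ofReal_sub _ (pow_nonneg (sub_nonneg.2 p.2.2) _), ENNReal.ofReal_one]
    _ ≤ _ := by
        refine ENNReal.ofReal_le_ofReal ?_
        have h := one_add_mul_le_pow (a := -(p : ℝ)) (by linarith [p.2.2]) F.card
        rw [← sub_eq_add_neg] at h
        nlinarith [p.2.1, mul_le_mul_of_nonneg_left hcard p.2.1]

/-! ### Comparison of powers -/

theorem eventually_const_mul_rpow_lt (C : ℝ) {a b : ℝ} (hab : a < b) :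
    ∀ᶠ D : ℕ in atTop, C * (D : ℝ) ^ a < (D : ℝ) ^ b := by
  have h := ((tendsto_rpow_atTop (sub_pos.2 hab)).comp
    tendsto_natCast_atTop_atTop).eventually_gt_atTop C
  filter_upwards [h, eventually_ge_atTop 1] with D hD h1
  have hpos : (0 : ℝ) < D := by exact_mod_cast h1
  calc C * (D : ℝ) ^ a < (D : ℝ) ^ (b - a) * (D : ℝ) ^ a :=
        mul_lt_mul_of_pos_right hD (Real.rpow_pos_of_pos hpos _)
    _ = (D : ℝ) ^ b := by rw [← Real.rpow_add hpos, sub_add_cancel]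

/-- A stretched exponential beats the number of boxes. -/
theorem tendsto_pow_mul_exp_one_sub_rpow (n : ℕ) {δ : ℝ} (hδ : 0 < δ) :
    Tendsto (fun D : ℕ => ((D : ℝ) + 1) ^ n * Real.exp (1 - (D : ℝ) ^ δ)) atTop (𝓝 0) := by
  have h := ((tendsto_rpow_mul_exp_neg_mul_atTop_nhds_zero (n / δ) 1 one_pos).comp
    ((tendsto_rpow_atTop hδ).comp tendsto_natCast_atTop_atTop)).const_mul (2 ^ n * Real.exp 1)
  rw [mul_zero] at h
  refine tendsto_of_tendsto_of_tendsto_of_le_of_le' tendsto_const_nhds h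
    (Eventually.of_forall fun D => by positivity) ?_
  filter_upwards [eventually_ge_atTop 1] with D hD
  have h1 : (1 : ℝ) ≤ D := by exact_mod_cast hD
  have h2 : ((D : ℝ) ^ δ) ^ ((n : ℝ) / δ) = (D : ℝ) ^ n := by
    rw [← Real.rpow_mul (by positivity), mul_div_cancel₀ _ hδ.ne', Real.rpow_natCast]
  simp only [Function.comp_apply, h2]
  calc ((D : ℝ) + 1) ^ n * Real.exp (1 - (D : ℝ) ^ δ)
      ≤ (2 * D) ^ n * Real.exp (1 - (D : ℝ) ^ δ) := by gcongr; linarith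
    _ = _ := by rw [mul_pow, sub_eq_add_neg, Real.exp_add]; simp only [neg_mul, one_mul]; ring

/-! ### Boxes hit and missed by the generators -/

/-- Asymptotically almost surely, every box of side lengths at most `D / n` whose volume is at
least `D ^ (k + δ)` contains a generator. All three parts use this one event: for the upper bounds, an
admissible pair gives a box without generators; for the lower bound, a generator in a box shows
that a pair is not admissible. -/
theorem aas_exists_le_of_le_prod {n : ℕ} {k : ℝ} {p : ℕ → unitInterval}
    (hp : ∀ D : ℕ, 1 ≤ D → (p D : ℝ) = (D : ℝ) ^ (-k)) {δ : ℝ} (hδ : 0 < δ) :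
    AAS (fun D => randomGenerators n D (p D)) fun D =>
      {B | ∀ c : Fin n →₀ ℕ, (∀ i, c i ≤ D / n) → (D : ℝ) ^ (k + δ) ≤ ∏ i, ((c i : ℝ) + 1) →
        ∃ b ∈ B, b ≤ c} := by
  classical
  rw [aas_iff_compl]
  have h := ENNReal.tendsto_ofReal (tendsto_pow_mul_exp_one_sub_rpow n hδ)
  rw [ENNReal.ofReal_zero] at h
  refine tendsto_of_tendsto_of_tendsto_of_le_of_le' tendsto_const_nhds h
    (Eventually.of_forall fun _ => zero_le) ?_
  filter_upwards [eventually_ge_atTop 1] with D hD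
  have hpos : (0 : ℝ) < D := by exact_mod_cast hD
  set m : Fin n →₀ ℕ := Finsupp.equivFunOnFinite.symm fun _ => D / n with hm
  set T := (Finset.Iic m).filter fun c => (D : ℝ) ^ (k + δ) ≤ ∏ i, ((c i : ℝ) + 1)
  have hT : (T.card : ℝ) ≤ ((D : ℝ) + 1) ^ n := by
    have h1 : T.card ≤ (D + 1) ^ n := by
      refine (Finset.card_filter_le _ _).trans ?_
      rw [card_Iic_eq_prod]
      simp only [hm, Finsupp.equivFunOnFinite_symm_apply_apply, Finset.prod_const,
        Finset.card_univ, Fintype.card_fin]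
      exact Nat.pow_le_pow_left (Nat.succ_le_succ (Nat.div_le_self _ _)) _
    exact_mod_cast h1
  calc _ ≤ (randomGenerators n D (p D)).toOuterMeasure (⋃ c ∈ T, {B | ∀ b ∈ B, ¬ b ≤ c}) := by
        refine MeasureTheory.measure_mono fun B hB => ?_
        simp only [Set.mem_compl_iff, Set.mem_ofPred_eq, not_forall] at hB
        obtain ⟨c, hc, hv, hB⟩ := hB
        simp only [Set.mem_iUnion]
        exact ⟨c, Finset.mem_filter.2 ⟨Finset.mem_Iic.2 fun i => by simpa [hm] using hc i, hv⟩,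
          fun b hb hbc => hB ⟨b, hb, hbc⟩⟩
    _ ≤ ∑ c ∈ T, (randomGenerators n D (p D)).toOuterMeasure {B | ∀ b ∈ B, ¬ b ≤ c} :=
        MeasureTheory.measure_biUnion_finset_le _ _
    _ ≤ ∑ _c ∈ T, ENNReal.ofReal (Real.exp (1 - (D : ℝ) ^ δ)) := by
        refine Finset.sum_le_sum fun c hc => ?_
        obtain ⟨hc, hv⟩ := Finset.mem_filter.1 hc
        have hcm : ∀ i, c i ≤ D / n := fun i => by simpa [hm] using Finset.mem_Iic.1 hc i
        refine (toOuterMeasure_forall_not_le (p D) ?_).trans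
          (ENNReal.ofReal_le_ofReal (Real.exp_le_exp.2 ?_))
        · calc ∑ i, c i ≤ ∑ _i : Fin n, D / n := Finset.sum_le_sum fun i _ => hcm i
            _ = n * (D / n) := by simp
            _ ≤ D := Nat.mul_div_le D n
        · have h2 : (D : ℝ) ^ δ = (p D : ℝ) * (D : ℝ) ^ (k + δ) := by
            rw [hp D hD, ← Real.rpow_add hpos]; congr 1; ring
          rw [h2]
          exact sub_le_sub_left (mul_le_mul_of_nonneg_left hv (p D).2.1) _
    _ ≤ _ := by
        rw [Finset.sum_const, nsmul_eq_mul, ENNReal.ofReal_mul (by positivity)]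
        gcongr
        rw [← ENNReal.ofReal_natCast]
        exact ENNReal.ofReal_le_ofReal hT

/-- Asymptotically almost surely, a box of volume `O(D ^ (k - δ))` contains no generator. -/
theorem aas_forall_not_le {n : ℕ} {k : ℝ} {p : ℕ → unitInterval}
    (hp : ∀ D : ℕ, 1 ≤ D → (p D : ℝ) = (D : ℝ) ^ (-k)) {c : ℕ → Fin n →₀ ℕ} {C δ : ℝ}
    (hδ : 0 < δ) (hc : ∀ᶠ D : ℕ in atTop, ∏ i, ((c D i : ℝ) + 1) ≤ C * (D : ℝ) ^ (k - δ)) :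
    AAS (fun D => randomGenerators n D (p D)) fun D => {B | ∀ b ∈ B, ¬ b ≤ c D} := by
  have key : AAS (fun D => randomGenerators n D (p D)) fun D =>
      {B | B ⊆ monomialsUpTo n D ∧ ∃ b ∈ B, b ≤ c D}ᶜ := by
    rw [aas_iff_compl]
    have h := ENNReal.tendsto_ofReal (((tendsto_rpow_neg_atTop hδ).comp
      tendsto_natCast_atTop_atTop).const_mul C)
    rw [mul_zero, ENNReal.ofReal_zero] at h
    refine tendsto_of_tendsto_of_tendsto_of_le_of_le' tendsto_const_nhds h
      (Eventually.of_forall fun _ => zero_le) ?_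
    filter_upwards [hc, eventually_ge_atTop 1] with D hD h1
    have hpos : (0 : ℝ) < D := by exact_mod_cast h1
    rw [compl_compl]
    refine (toOuterMeasure_exists_le (p D) (c D)).trans (ENNReal.ofReal_le_ofReal ?_)
    calc (p D : ℝ) * ∏ i, ((c D i : ℝ) + 1) ≤ p D * (C * (D : ℝ) ^ (k - δ)) :=
          mul_le_mul_of_nonneg_left hD (p D).2.1
      _ = C * (D : ℝ) ^ (-δ) := by
          rw [hp D h1, mul_left_comm, ← Real.rpow_add hpos]; congr 2; ring
  refine (key.inter (aas_subset_monomialsUpTo p)).mono (Eventually.of_forall fun D B hB b hb hbc => ?_)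
  exact hB.1 ⟨hB.2, b, hb, hbc⟩

/-! ### Admissible and standard pairs of a monomial ideal -/

section Pairs

variable {K : Type*} [Field K] {n : ℕ} {B : Finset (Fin n →₀ ℕ)} {α : Fin n →₀ ℕ}
  {S : Finset (Fin n)}

theorem monomial_mem_monomialIdeal {β : Fin n →₀ ℕ} :
    MvPolynomial.monomial β (1 : K) ∈ monomialIdeal K B ↔ ∃ b ∈ B, b ≤ β := by
  classical
  rw [monomialIdeal, MvPolynomial.mem_ideal_span_monomial_image]
  simp [MvPolynomial.support_monomial]

theorem isAdmissiblePair_monomialIdeal_iff :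
    IsAdmissiblePair (monomialIdeal K B) α S ↔
      Disjoint α.support S ∧ ∀ b ∈ B, ∃ i ∉ S, α i < b i := by
  classical
  refine and_congr_right fun hd => ⟨fun h b hb => ?_, fun h γ hγ hmem => ?_⟩
  · by_contra! hcon
    refine h (b.filter (· ∈ S)) (fun i hi => ?_) (monomial_mem_monomialIdeal.2 ⟨b, hb, fun i => ?_⟩)
    · rw [Finsupp.support_filter] at hi
      exact (Finset.mem_filter.1 hi).2
    · by_cases hi : i ∈ S
      · simp [hi]
      · simpa [hi] using hcon i hi
  · obtain ⟨b, hb, hle⟩ := monomial_mem_monomialIdeal.1 hmem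
    obtain ⟨i, hi, hlt⟩ := h b hb
    have hγi : γ i = 0 := Finsupp.notMem_support_iff.1 fun h' => hi (hγ h')
    have := hle i
    rw [Finsupp.add_apply, hγi] at this
    omega

/-- If `x_i` has exponent at least `D` in `x^α`, then no generator of degree at most `D`
distinguishes `(x^α, S)` from the smaller pair obtained by moving `x_i` to `S`. -/
theorem IsStandardPair.lt_of_notMem {D : ℕ} (hB : B ⊆ monomialsUpTo n D)
    (h : IsStandardPair (monomialIdeal K B) α S) {i : Fin n} (hi : i ∉ S) : α i < D := by
  classical
  by_contra! hD
  obtain ⟨had, hmin⟩ := h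
  rw [isAdmissiblePair_monomialIdeal_iff] at had
  have hT := (hmin (α.erase i) (insert i S) ?_ ⟨?_, ?_⟩).2
  · exact hi (hT ▸ Finset.mem_insert_self i S)
  · rw [isAdmissiblePair_monomialIdeal_iff]
    refine ⟨?_, fun b hb => ?_⟩
    · rw [Finsupp.support_erase, Finset.disjoint_left]
      intro j hj hjS
      obtain ⟨hji, hj⟩ := Finset.mem_erase.1 hj
      exact Finset.disjoint_left.1 had.1 hj ((Finset.mem_insert.1 hjS).resolve_left hji)
    · obtain ⟨j, hj, hlt⟩ := had.2 b hb
      have hbD : b j ≤ D := (Finset.single_le_sum (fun _ _ => Nat.zero_le _)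
        (Finset.mem_univ j)).trans (mem_monomialsUpTo.1 (hB hb)).2
      have hji : j ≠ i := by rintro rfl; omega
      exact ⟨j, by simp [hji, hj], by rwa [Finsupp.erase_ne hji]⟩
  · intro j
    rw [Finsupp.erase_apply]
    split_ifs <;> simp
  · refine Finset.union_subset (fun j hj => ?_) (Finset.subset_insert i S)
    by_contra hj'
    have hji : j ≠ i := by rintro rfl; simp at hj'
    simp [Finsupp.erase_ne hji] at hj

/-- Minimality needs to be tested only against the pairs that enlarge `S` by one variable. -/
theorem isStandardPair_of_forall_exists (hd : Disjoint α.support S)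
    (had : ∀ b ∈ B, ∃ i ∉ S, α i < b i)
    (hmin : ∀ i ∉ S, ∃ b ∈ B, ∀ j ∉ insert i S, b j ≤ α j) :
    IsStandardPair (monomialIdeal K B) α S := by
  classical
  refine ⟨isAdmissiblePair_monomialIdeal_iff.2 ⟨hd, had⟩, ?_⟩
  rintro β T hβ ⟨hle, hsub⟩
  rw [isAdmissiblePair_monomialIdeal_iff] at hβ
  obtain ⟨hsupp, hST⟩ := Finset.union_subset_iff.1 hsub
  have heq : ∀ j ∉ T, α j = β j := fun j hj => by
    have h0 : (α - β) j = 0 := Finsupp.notMem_support_iff.1 fun h => hj (hsupp h)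
    have := hle j
    rw [Finsupp.tsub_apply] at h0
    omega
  have hTS : T = S := by
    refine Finset.Subset.antisymm (fun i hiT => ?_) hST
    by_contra hiS
    obtain ⟨b, hb, hbα⟩ := hmin i hiS
    obtain ⟨j, hjT, hlt⟩ := hβ.2 b hb
    have := hbα j fun hj => hjT (Finset.insert_subset hiT hST hj)
    rw [heq j hjT] at this
    omega
  subst hTS
  refine ⟨?_, rfl⟩
  ext j
  by_cases hj : j ∈ T
  · have h0 : α j = 0 := Finsupp.notMem_support_iff.1 fun h => Finset.disjoint_left.1 hd h hj
    have := hle j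
    omega
  · exact (heq j hj).symm

theorem IsStandardPair.eq_zero_of_mem {I : Ideal (MvPolynomial (Fin n) K)}
    (h : IsStandardPair I α S) {i : Fin n} (hi : i ∈ S) : α i = 0 :=
  Finsupp.notMem_support_iff.1 fun h' => Finset.disjoint_left.1 h.1.1 h' hi

end Pairs

/-! ### Counting lattice points under a hyperbola -/

theorem Z_mono (t : ℕ) {d e : ℝ} (h : d ≤ e) : Z t d ≤ Z t e :=
  Set.ncard_le_ncard (fun _ hα => le_trans hα h) (Z_finite t e)

theorem Z_lt_Z {t : ℕ} (ht : 0 < t) {d e : ℝ} (h1 : 1 ≤ e) (h : d + 1 ≤ e) : Z t d < Z t e := by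
  have hsub : {α : Fin t → ℕ | ∏ i, ((α i : ℝ) + 1) ≤ d} ⊆ {α | ∏ i, ((α i : ℝ) + 1) ≤ e} :=
    fun _ hα => le_trans hα (show d ≤ e by linarith)
  refine Set.ncard_lt_ncard ((Set.ssubset_iff_of_subset hsub).2
    ⟨Pi.single ⟨0, ht⟩ (⌊e⌋₊ - 1), ?_⟩) (Z_finite t e)
  have hfl : 1 ≤ ⌊e⌋₊ := Nat.le_floor (by simpa using h1)
  have hprod : ∏ i : Fin t, (((Pi.single ⟨0, ht⟩ (⌊e⌋₊ - 1) : Fin t → ℕ) i : ℝ) + 1) = ⌊e⌋₊ := by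
    rw [Finset.prod_eq_single ⟨0, ht⟩]
    · simp [Nat.cast_sub hfl]
    · intro j _ hj
      simp [Pi.single_eq_of_ne hj]
    · simp
  simp only [Set.mem_ofPred_eq, hprod, not_le]
  exact ⟨Nat.floor_le (by linarith), by linarith [Nat.lt_floor_add_one e]⟩

/-- Rankin's trick: each counted point contributes at least `1` to
`∑ (d / ∏ (α i + 1)) ^ a`, and this sum is at most `d ^ a * ζ(a) ^ t`. -/
theorem exists_Z_le_mul_rpow (t : ℕ) {a : ℝ} (ha : 1 < a) :
    ∃ C : ℝ, ∀ d : ℝ, 0 < d → (Z t d : ℝ) ≤ C * d ^ a := by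
  classical
  have hsum : Summable fun m : ℕ => (((m : ℝ) + 1) ^ a)⁻¹ := by
    have := (summable_nat_add_iff 1).2 (Real.summable_nat_rpow_inv.2 ha)
    simpa using this
  refine ⟨(∑' m : ℕ, (((m : ℝ) + 1) ^ a)⁻¹) ^ t, fun d hd => ?_⟩
  have hbox : ∀ α : Fin t → ℕ, ∏ i, ((α i : ℝ) + 1) ≤ d →
      α ∈ Fintype.piFinset fun _ : Fin t => Finset.range (⌊d⌋₊ + 1) := by
    intro α hα
    rw [Fintype.mem_piFinset]
    intro i
    rw [Finset.mem_range, Nat.lt_succ_iff]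
    refine Nat.le_floor (le_trans ?_ hα)
    rw [← Finset.mul_prod_erase _ _ (Finset.mem_univ i)]
    have h : (1 : ℝ) ≤ ∏ j ∈ Finset.univ.erase i, ((α j : ℝ) + 1) :=
      Finset.prod_const_one.symm.le.trans
        (Finset.prod_le_prod (fun _ _ => zero_le_one) fun j _ => by simp)
    nlinarith [(α i).cast_nonneg (α := ℝ)]
  have hZ : Z t d = ((Fintype.piFinset fun _ : Fin t => Finset.range (⌊d⌋₊ + 1)).filter
      fun α => ∏ i, ((α i : ℝ) + 1) ≤ d).card := by
    rw [Z, ← Set.ncard_coe_finset]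
    congr 1
    ext α
    simp only [Set.mem_ofPred_eq, Finset.coe_filter]
    exact ⟨fun h => ⟨hbox α h, h⟩, fun h => h.2⟩
  rw [hZ, Finset.card_eq_sum_ones, Nat.cast_sum, Nat.cast_one]
  calc ∑ _α ∈ (Fintype.piFinset fun _ : Fin t => Finset.range (⌊d⌋₊ + 1)).filter
        (fun α => ∏ i, ((α i : ℝ) + 1) ≤ d), (1 : ℝ)
      ≤ ∑ α ∈ (Fintype.piFinset fun _ : Fin t => Finset.range (⌊d⌋₊ + 1)).filter
        (fun α => ∏ i, ((α i : ℝ) + 1) ≤ d), d ^ a * ∏ i, (((α i : ℝ) + 1) ^ a)⁻¹ := by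
        refine Finset.sum_le_sum fun α hα => ?_
        have hle := (Finset.mem_filter.1 hα).2
        have hpos : 0 < ∏ i, ((α i : ℝ) + 1) := Finset.prod_pos fun i _ => by positivity
        rw [Finset.prod_inv_distrib, Real.finsetProd_rpow _ _ (fun i _ => by positivity),
          ← div_eq_mul_inv, one_le_div (Real.rpow_pos_of_pos hpos _)]
        exact Real.rpow_le_rpow hpos.le hle (by linarith)
    _ ≤ ∑ α ∈ Fintype.piFinset fun _ : Fin t => Finset.range (⌊d⌋₊ + 1),
          d ^ a * ∏ i, (((α i : ℝ) + 1) ^ a)⁻¹ :=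
        Finset.sum_le_sum_of_subset_of_nonneg (Finset.filter_subset _ _)
          fun _ _ _ => mul_nonneg (by positivity) (Finset.prod_nonneg fun _ _ => by positivity)
    _ = d ^ a * (∑ m ∈ Finset.range (⌊d⌋₊ + 1), (((m : ℝ) + 1) ^ a)⁻¹) ^ t := by
        rw [← Finset.mul_sum, Finset.sum_prod_piFinset (Finset.range (⌊d⌋₊ + 1))
          fun (_ : Fin t) m => (((m : ℝ) + 1) ^ a)⁻¹]
        simp
    _ ≤ _ := by
        rw [mul_comm]
        gcongr
        exact hsum.sum_le_tsum _ fun _ _ => by positivity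

/-- Dropping the coordinates in `S`, where the exponents vanish, turns the exponents counted here
into points counted by `Z`. -/
theorem finite_and_ncard_le_Z {n : ℕ} {S : Finset (Fin n)} {d : ℝ} {W : Set (Fin n →₀ ℕ)}
    (hS : ∀ α ∈ W, ∀ i ∈ S, α i = 0) (hW : ∀ α ∈ W, ∏ i, ((α i : ℝ) + 1) ≤ d) :
    W.Finite ∧ W.ncard ≤ Z (n - S.card) d := by
  classical
  have hcard : Fintype.card {i // i ∉ S} = n - S.card := by
    rw [Fintype.card_subtype_compl]; simp
  let e : Fin (n - S.card) ≃ {i // i ∉ S} := (Fintype.equivFinOfCardEq hcard).symm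
  let f : (Fin n →₀ ℕ) → Fin (n - S.card) → ℕ := fun α j => α (e j)
  have hmaps : Set.MapsTo f W {α | ∏ i, ((α i : ℝ) + 1) ≤ d} := by
    intro α hα
    refine le_trans (le_of_eq ?_) (hW α hα)
    calc ∏ j, ((f α j : ℝ) + 1) = ∏ i : {i // i ∉ S}, ((α i : ℝ) + 1) :=
          Equiv.prod_comp e fun i : {i // i ∉ S} => ((α i : ℝ) + 1)
      _ = ∏ i ∈ Finset.univ.filter (· ∉ S), ((α i : ℝ) + 1) :=
          (Finset.prod_subtype _ (by simp) fun i => ((α i : ℝ) + 1)).symm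
      _ = ∏ i, ((α i : ℝ) + 1) := by
          refine Finset.prod_subset (Finset.subset_univ _) fun i _ hi => ?_
          have : i ∈ S := by simpa using hi
          simp [hS α hα i this]
  have hinj : Set.InjOn f W := by
    intro α hα β hβ h
    ext i
    by_cases hi : i ∈ S
    · rw [hS α hα i hi, hS β hβ i hi]
    · simpa [f] using congrFun h (e.symm ⟨i, hi⟩)
  exact ⟨Set.Finite.of_injOn hmaps hinj (Z_finite _ d),
    Set.ncard_le_ncard_of_injOn f hmaps hinj (Z_finite _ d)⟩

/-! ### Box sizes -/

/-- The exponent vector that is `a` on `S` and `b` elsewhere. -/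
def twoValued {n : ℕ} (S : Finset (Fin n)) (a b : ℕ) : Fin n →₀ ℕ :=
  Finsupp.equivFunOnFinite.symm fun i => if i ∈ S then a else b

theorem twoValued_apply {n : ℕ} (S : Finset (Fin n)) (a b : ℕ) (i : Fin n) :
    twoValued S a b i = if i ∈ S then a else b := rfl

theorem prod_ite_mem {n : ℕ} {R : Type*} [CommMonoid R] (S : Finset (Fin n)) (x y : R) :
    ∏ i, (if i ∈ S then x else y) = x ^ S.card * y ^ (n - S.card) := by
  classical
  rw [Finset.prod_ite, Finset.prod_const, Finset.prod_const, Finset.filter_mem_eq_inter,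
    Finset.univ_inter, ← Finset.compl_filter, Finset.filter_mem_eq_inter, Finset.univ_inter,
    Finset.card_compl, Fintype.card_fin]

theorem prod_twoValued {n : ℕ} (S : Finset (Fin n)) (a b : ℕ) :
    ∏ i, ((twoValued S a b i : ℝ) + 1) = ((a : ℝ) + 1) ^ S.card * ((b : ℝ) + 1) ^ (n - S.card) := by
  rw [← prod_ite_mem]
  refine Finset.prod_congr rfl fun i _ => ?_
  rw [twoValued_apply]
  split_ifs <;> rfl

theorem card_Icc_twoValued {n : ℕ} (S : Finset (Fin n)) (h : ℕ) :
    (Finset.Icc (twoValued S 0 h) (twoValued S 0 (2 * h))).card = (h + 1) ^ (n - S.card) := by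
  classical
  have hp := prod_ite_mem S 1 (h + 1)
  rw [one_pow, one_mul] at hp
  rw [Finsupp.card_Icc, ← hp, Finset.prod_subset (Finset.subset_univ _)]
  · refine Finset.prod_congr rfl fun i _ => ?_
    simp only [twoValued_apply, Nat.card_Icc]
    split_ifs <;> omega
  · intro i _ hi
    simp only [Finset.mem_union, Finsupp.mem_support_iff, not_or, not_not] at hi
    simp [hi.1, hi.2]

theorem cast_le_mul_div_add_one {n : ℕ} (hn : 0 < n) (D : ℕ) :
    (D : ℝ) ≤ n * (((D / n : ℕ) : ℝ) + 1) := by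
  exact_mod_cast (Nat.lt_mul_div_succ D hn).le

/-! ### The standard pairs of the random ideal -/

section Random

variable {K : Type*} [Field K] {n : ℕ} {k : ℝ} {p : ℕ → unitInterval}

/-- A standard pair `(x^α, S)` gives a box of side lengths at most `D / n` without generators:
truncate `α` at `D / n` outside `S` and take `D / n` on `S`. Since `α i < D`, truncation shrinks
each side at most by the factor `n`. -/
theorem aas_prod_standardPair_lt (hn : 0 < n) (S : Finset (Fin n))
    (hp : ∀ D : ℕ, 1 ≤ D → (p D : ℝ) = (D : ℝ) ^ (-k)) {δ : ℝ} (hδ : 0 < δ) :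
    AAS (fun D => randomGenerators n D (p D)) fun D =>
      {B | ∀ α ∈ standardPairs (monomialIdeal K B) S,
        ∏ i, ((α i : ℝ) + 1) < (n : ℝ) ^ n * (D : ℝ) ^ (k - S.card + δ)} := by
  classical
  refine ((aas_exists_le_of_le_prod hp hδ).inter (aas_subset_monomialsUpTo p)).mono ?_
  filter_upwards [eventually_ge_atTop 1] with D hD B hB α hα
  obtain ⟨hbox, hBU⟩ := hB
  have hpos : (0 : ℝ) < D := by exact_mod_cast hD
  set c : Fin n →₀ ℕ := Finsupp.equivFunOnFinite.symm fun i =>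
    if i ∈ S then D / n else min (α i) (D / n) with hc
  have hci : ∀ i, c i = if i ∈ S then D / n else min (α i) (D / n) := fun i => rfl
  have hlt : ∏ i, ((c i : ℝ) + 1) < (D : ℝ) ^ (k + δ) := by
    by_contra! hge
    obtain ⟨b, hb, hbc⟩ := hbox c (fun i => by rw [hci]; split_ifs <;> simp) hge
    obtain ⟨i, hi, hlt⟩ := (isAdmissiblePair_monomialIdeal_iff.1 hα.1).2 b hb
    have := hbc i
    rw [hci, if_neg hi] at this
    exact absurd (this.trans (min_le_left _ _)) (not_le.2 hlt)
  have hside : ∀ i, ((α i : ℝ) + 1) * (if i ∈ S then (D : ℝ) else 1) ≤ n * ((c i : ℝ) + 1) := by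
    intro i
    rw [hci]
    split_ifs with hi
    · rw [IsStandardPair.eq_zero_of_mem hα hi, Nat.cast_zero, zero_add, one_mul]
      exact cast_le_mul_div_add_one hn D
    · have hαD := IsStandardPair.lt_of_notMem hBU hα hi
      have h1 : α i + 1 ≤ n * (min (α i) (D / n) + 1) := by
        rcases min_cases (α i) (D / n) with ⟨h, _⟩ | ⟨h, _⟩ <;> rw [h]
        · exact Nat.le_mul_of_pos_left _ hn
        · exact (Nat.succ_le_of_lt hαD).trans (Nat.lt_mul_div_succ D hn).le
      rw [mul_one]
      exact_mod_cast h1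
  have hprod := Finset.prod_le_prod (s := Finset.univ)
    (fun i _ => mul_nonneg (by positivity) (by split_ifs <;> positivity)) fun i _ => hside i
  rw [Finset.prod_mul_distrib, Finset.prod_mul_distrib, prod_ite_mem, one_pow, mul_one,
    Finset.prod_const, Finset.card_univ, Fintype.card_fin] at hprod
  have hDs : (0 : ℝ) < (D : ℝ) ^ S.card := by positivity
  have hexp : (D : ℝ) ^ (k - S.card + δ) * (D : ℝ) ^ S.card = (D : ℝ) ^ (k + δ) := by
    rw [← Real.rpow_natCast, ← Real.rpow_add hpos]; congr 1; ring
  refine lt_of_mul_lt_mul_right (hprod.trans_lt ?_) hDs.le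
  rw [mul_assoc, hexp]
  exact mul_lt_mul_of_pos_left hlt (by positivity)

theorem aas_ncard_standardPairs_lt (S : Finset (Fin n)) (hS : S.card < n)
    (hSk : (S.card : ℝ) ≤ k) (hp : ∀ D : ℕ, 1 ≤ D → (p D : ℝ) = (D : ℝ) ^ (-k)) {ε : ℝ}
    (hε : 0 < ε) :
    AAS (fun D => randomGenerators n D (p D)) fun D =>
      {B | (standardPairs (monomialIdeal K B) S).Finite ∧
        (standardPairs (monomialIdeal K B) S).ncard <
          Z (n - S.card) ((D : ℝ) ^ (k - S.card + ε))} := by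
  refine (aas_prod_standardPair_lt (K := K) (by omega) S hp (half_pos hε)).mono ?_
  filter_upwards [eventually_ge_atTop 1,
    eventually_const_mul_rpow_lt ((n : ℝ) ^ n + 1)
      (show k - S.card + ε / 2 < k - S.card + ε by linarith)] with D hD hlt B hB
  have h1 : (1 : ℝ) ≤ D := by exact_mod_cast hD
  obtain ⟨hfin, hle⟩ := finite_and_ncard_le_Z
    (fun α hα i hi => IsStandardPair.eq_zero_of_mem hα hi) fun α hα => (hB α hα).le
  have h2 : 1 ≤ (D : ℝ) ^ (k - S.card + ε / 2) := Real.one_le_rpow h1 (by linarith)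
  exact ⟨hfin, hle.trans_lt (Z_lt_Z (by omega) (Real.one_le_rpow h1 (by linarith))
    (by linarith))⟩

/-- A standard pair would give `1 ≤ ∏ (α i + 1) < n ^ n * D ^ (k - s + δ)`, where the exponent of
`D` is negative. -/
theorem aas_standardPairs_eq_empty (hn : 0 < n) (S : Finset (Fin n)) (hSk : k < S.card)
    (hp : ∀ D : ℕ, 1 ≤ D → (p D : ℝ) = (D : ℝ) ^ (-k)) :
    AAS (fun D => randomGenerators n D (p D)) fun _ =>
      {B | standardPairs (monomialIdeal K B) S = ∅} := by
  refine (aas_prod_standardPair_lt (K := K) hn S hp (δ := (S.card - k) / 2) (by linarith)).mono ?_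
  filter_upwards [eventually_const_mul_rpow_lt ((n : ℝ) ^ n)
      (show k - S.card + (S.card - k) / 2 < 0 by linarith)] with D hlt B hB
  rw [Real.rpow_zero] at hlt
  refine Set.eq_empty_of_forall_notMem fun α hα => ?_
  have h1 : (1 : ℝ) ≤ ∏ i, ((α i : ℝ) + 1) := by
    exact_mod_cast Nat.one_le_iff_ne_zero.2
      (Finset.prod_ne_zero_iff.2 fun i _ => Nat.succ_ne_zero (α i))
  linarith [hB α hα]

/-- The cube of exponents between `h` and `2 * h` outside `S`, with `h = ⌊D ^ a⌋` and
`a = (k - s - η) / t`, consists of standard pairs: its lower set contains so few monomials that no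
generator excludes admissibility, while enlarging `S` by one variable gains a factor of about
`D ^ (1 - a)`, which makes all the smaller pairs inadmissible. -/
theorem aas_Icc_subset_standardPairs (S : Finset (Fin n)) (hS : S.card < n) {η a : ℝ}
    (hη : 0 < η) (ha : 0 < a) (haη : a + η < 1) (hat : a * (n - S.card : ℕ) = k - S.card - η)
    (hp : ∀ D : ℕ, 1 ≤ D → (p D : ℝ) = (D : ℝ) ^ (-k)) :
    AAS (fun D => randomGenerators n D (p D)) fun D =>
      {B | (Finset.Icc (twoValued S 0 ⌊(D : ℝ) ^ a⌋₊) (twoValued S 0 (2 * ⌊(D : ℝ) ^ a⌋₊)) :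
        Set (Fin n →₀ ℕ)) ⊆ standardPairs (monomialIdeal K B) S} := by
  classical
  have hmiss : AAS (fun D => randomGenerators n D (p D)) fun D =>
      {B | ∀ b ∈ B, ¬ b ≤ twoValued S D (2 * ⌊(D : ℝ) ^ a⌋₊)} := by
    refine aas_forall_not_le hp (C := 2 ^ S.card * 3 ^ (n - S.card)) hη ?_
    filter_upwards [eventually_ge_atTop 1] with D hD
    have h1 : (1 : ℝ) ≤ D := by exact_mod_cast hD
    have hpos : (0 : ℝ) < D := by linarith
    have h2 : 1 ≤ (D : ℝ) ^ a := Real.one_le_rpow h1 ha.le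
    have h3 := Nat.floor_le (zero_le_one.trans h2)
    rw [prod_twoValued]
    calc ((D : ℝ) + 1) ^ S.card * (((2 * ⌊(D : ℝ) ^ a⌋₊ : ℕ) : ℝ) + 1) ^ (n - S.card)
        ≤ (2 * D) ^ S.card * (3 * (D : ℝ) ^ a) ^ (n - S.card) := by
          push_cast
          gcongr <;> linarith
      _ = 2 ^ S.card * 3 ^ (n - S.card) *
            ((D : ℝ) ^ (S.card : ℝ) * (D : ℝ) ^ (a * (n - S.card : ℕ))) := by
          rw [Real.rpow_natCast, Real.rpow_mul hpos.le, Real.rpow_natCast]; ring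
      _ = _ := by
          rw [← Real.rpow_add hpos, hat]; congr 2; ring
  refine ((hmiss.inter (aas_subset_monomialsUpTo p)).inter
    (aas_exists_le_of_le_prod hp (δ := (1 - a - η) / 2) (by linarith))).mono ?_
  filter_upwards [eventually_ge_atTop 1,
    eventually_const_mul_rpow_lt (n : ℝ) (show a < 1 by linarith),
    eventually_const_mul_rpow_lt ((n : ℝ) ^ (S.card + 1))
      (show k + (1 - a - η) / 2 < k + (1 - a - η) by linarith)] with D hD hh hvol B hB α hα
  obtain ⟨⟨hmissB, hBU⟩, hbox⟩ := hB
  have hpos : (0 : ℝ) < D := by exact_mod_cast hD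
  have hnpos : 0 < n := by omega
  set h := ⌊(D : ℝ) ^ a⌋₊
  obtain ⟨hlo, hhi⟩ := Finset.mem_Icc.1 (Finset.mem_coe.1 hα)
  have hhn : h ≤ D / n := by
    rw [Nat.le_div_iff_mul_le hnpos]
    have h1 : (h : ℝ) ≤ (D : ℝ) ^ a := Nat.floor_le (by positivity)
    have h2 : (h : ℝ) * n ≤ D := by
      rw [Real.rpow_one] at hh
      nlinarith [n.cast_nonneg (α := ℝ)]
    exact_mod_cast h2
  refine isStandardPair_of_forall_exists ?_ (fun b hb => ?_) fun i hi => ?_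
  · refine Finset.disjoint_left.2 fun i hi hiS => Finsupp.mem_support_iff.1 hi ?_
    have := hhi i
    rw [twoValued_apply, if_pos hiS] at this
    omega
  · by_contra! hcon
    refine hmissB b hb fun i => ?_
    rw [twoValued_apply]
    split_ifs with hi
    · exact (Finset.single_le_sum (fun _ _ => Nat.zero_le _) (Finset.mem_univ i)).trans
        (mem_monomialsUpTo.1 (hBU hb)).2
    · have := hhi i
      rw [twoValued_apply, if_neg hi] at this
      exact (hcon i hi).trans this
  · have hcard : (insert i S).card = S.card + 1 := Finset.card_insert_of_notMem hi
    have hprod : (D : ℝ) ^ (k + (1 - a - η) / 2) ≤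
        ∏ j, ((twoValued (insert i S) (D / n) h j : ℝ) + 1) := by
      rw [prod_twoValued, hcard]
      have hnn : (0 : ℝ) < (n : ℝ) ^ (S.card + 1) := by positivity
      refine le_of_mul_le_mul_left (hvol.le.trans ?_) hnn
      have hexp : a * (n - (S.card + 1) : ℕ) = k - S.card - η - a := by
        have h1 : ((n - S.card : ℕ) : ℝ) = (n - (S.card + 1) : ℕ) + 1 := by
          rw [← Nat.cast_add_one]; congr 1; omega
        rw [← hat, h1]; ring
      calc (D : ℝ) ^ (k + (1 - a - η))
          = (D : ℝ) ^ ((S.card + 1 : ℕ) : ℝ) * (D : ℝ) ^ (a * (n - (S.card + 1) : ℕ)) := by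
            rw [← Real.rpow_add hpos, hexp]; congr 1; push_cast; ring
        _ = (D : ℝ) ^ (S.card + 1) * ((D : ℝ) ^ a) ^ (n - (S.card + 1)) := by
            rw [Real.rpow_natCast, Real.rpow_mul hpos.le, Real.rpow_natCast]
        _ ≤ (n * (((D / n : ℕ) : ℝ) + 1)) ^ (S.card + 1) * ((h : ℝ) + 1) ^ (n - (S.card + 1)) := by
            gcongr
            · exact cast_le_mul_div_add_one hnpos D
            · exact (Nat.lt_floor_add_one _).le
        _ = _ := by rw [mul_pow, mul_assoc]
    obtain ⟨b, hb, hbc⟩ := hbox (twoValued (insert i S) (D / n) h)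
      (fun j => by rw [twoValued_apply]; split_ifs; exacts [le_rfl, hhn]) hprod
    refine ⟨b, hb, fun j hj => ?_⟩
    have h1 := hbc j
    have h2 := hlo j
    rw [twoValued_apply, if_neg hj] at h1
    rw [twoValued_apply, if_neg fun h => hj (Finset.mem_insert_of_mem h)] at h2
    exact h1.trans h2

/-- The cube of standard pairs has about `D ^ (k - s - η)` elements, and by Rankin's bound this is
a larger power of `D` than `Z t (D ^ (k - s - ε))` for `η` less than `ε`. -/
theorem aas_Z_lt_ncard_standardPairs (S : Finset (Fin n)) (hkn : k < n) (hSk : (S.card : ℝ) < k)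
    (hp : ∀ D : ℕ, 1 ≤ D → (p D : ℝ) = (D : ℝ) ^ (-k)) {ε : ℝ} (hε : 0 < ε) :
    AAS (fun D => randomGenerators n D (p D)) fun D =>
      {B | Z (n - S.card) ((D : ℝ) ^ (k - S.card - ε)) <
        (standardPairs (monomialIdeal K B) S).ncard} := by
  have hS : S.card < n := by exact_mod_cast hSk.trans hkn
  set t := n - S.card with ht
  have htn : (t : ℝ) = n - S.card := by rw [ht, Nat.cast_sub hS.le]
  have htpos : (0 : ℝ) < t := by rw [htn]; linarith
  have hm : 0 < k - S.card := by linarith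
  have hq : (k - S.card) / t < 1 := by rw [div_lt_one htpos, htn]; linarith
  -- It suffices to treat small `ε'`, for which `η = ε' / 2` satisfies `η < k - s` and `a + η < 1`.
  set ε' := min ε (min (k - S.card) (1 - (k - S.card) / t)) with hε'
  have hε'pos : 0 < ε' := lt_min hε (lt_min hm (by linarith))
  have hε'ε : ε' ≤ ε := min_le_left _ _
  have hε'm : ε' ≤ k - S.card := (min_le_right _ _).trans (min_le_left _ _)
  have hε'q : ε' ≤ 1 - (k - S.card) / t := (min_le_right _ _).trans (min_le_right _ _)
  set a := (k - S.card - ε' / 2) / t with ha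
  have hapos : 0 < a := div_pos (by linarith) htpos
  have haq : a ≤ (k - S.card) / t := div_le_div_of_nonneg_right (by linarith) htpos.le
  have hat : a * t = k - S.card - ε' / 2 := div_mul_cancel₀ _ htpos.ne'
  set ρ := ε' / (4 * (k - S.card)) with hρ
  have hρpos : 0 < ρ := by positivity
  have hρm : (k - S.card) * ρ = ε' / 4 := by rw [hρ]; field_simp
  obtain ⟨C, hC⟩ := exists_Z_le_mul_rpow t (show 1 < 1 + ρ by linarith)
  have hexp : (k - S.card - ε') * (1 + ρ) < k - S.card - ε' / 2 := by nlinarith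
  refine ((aas_Icc_subset_standardPairs (K := K) S hS (half_pos hε'pos) hapos (by linarith) hat
    hp).inter (aas_ncard_standardPairs_lt (K := K) S hS hSk.le hp one_pos)).mono ?_
  filter_upwards [eventually_ge_atTop 1, eventually_const_mul_rpow_lt C hexp] with D hD hlt B hB
  obtain ⟨hsub, hfin, -⟩ := hB
  have h1 : (1 : ℝ) ≤ D := by exact_mod_cast hD
  have hpos : (0 : ℝ) < D := by linarith
  have hcard := Set.ncard_le_ncard hsub hfin
  rw [Set.ncard_coe_finset, card_Icc_twoValued] at hcard
  have hreal : (Z t ((D : ℝ) ^ (k - S.card - ε)) : ℝ) <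
      ((⌊(D : ℝ) ^ a⌋₊ + 1) ^ t : ℕ) := by
    calc (Z t ((D : ℝ) ^ (k - S.card - ε)) : ℝ) ≤ Z t ((D : ℝ) ^ (k - S.card - ε')) := by
          exact_mod_cast Z_mono t (Real.rpow_le_rpow_of_exponent_le h1 (by linarith))
      _ ≤ C * ((D : ℝ) ^ (k - S.card - ε')) ^ (1 + ρ) := hC _ (Real.rpow_pos_of_pos hpos _)
      _ = C * (D : ℝ) ^ ((k - S.card - ε') * (1 + ρ)) := by rw [Real.rpow_mul hpos.le]
      _ < (D : ℝ) ^ (k - S.card - ε' / 2) := hlt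
      _ = ((D : ℝ) ^ a) ^ t := by rw [← hat, Real.rpow_mul hpos.le, Real.rpow_natCast]
      _ ≤ _ := by
          push_cast
          gcongr
          exact (Nat.lt_floor_add_one _).le
  exact lt_of_lt_of_le (by exact_mod_cast hreal) hcard

end Random

end RandomMonomialIdeal

end

theorem theorem2 {K : Type*} [Field K] {n : ℕ} (S : Finset (Fin n)) (k : ℝ) (hk0 : 0 < k)
    (hkn : k < n) (p : ℕ → unitInterval) (hp : ∀ D : ℕ, 1 ≤ D → (p D : ℝ) = (D : ℝ) ^ (-k)) :
    ((S.card : ℝ) < k → ∃ C : ℝ, 0 < C ∧ ∀ ε : ℝ, 0 < ε →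
      RandomMonomialIdeal.AAS (fun D => RandomMonomialIdeal.randomIdeal K n D (p D)) (fun D =>
        {I | (RandomMonomialIdeal.standardPairs I S).Finite ∧
          C * (RandomMonomialIdeal.Z (n - S.card) ((D : ℝ) ^ (k - S.card - ε)) : ℝ) <
            ((RandomMonomialIdeal.standardPairs I S).ncard : ℝ) ∧
          (RandomMonomialIdeal.standardPairs I S).ncard <
            RandomMonomialIdeal.Z (n - S.card) ((D : ℝ) ^ (k - S.card + ε))})) ∧
    ((S.card : ℝ) = k → ∀ ε : ℝ, 0 < ε →
      RandomMonomialIdeal.AAS (fun D => RandomMonomialIdeal.randomIdeal K n D (p D)) (fun D =>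
        {I | (RandomMonomialIdeal.standardPairs I S).Finite ∧
          (RandomMonomialIdeal.standardPairs I S).ncard <
            RandomMonomialIdeal.Z (n - S.card) ((D : ℝ) ^ (k - S.card + ε))})) ∧
    (k < (S.card : ℝ) →
      RandomMonomialIdeal.AAS (fun D => RandomMonomialIdeal.randomIdeal K n D (p D)) (fun _ =>
        {I | RandomMonomialIdeal.standardPairs I S = ∅})) := by
  have hn : 0 < n := by exact_mod_cast hk0.trans hkn
  refine ⟨fun hSk => ⟨1, one_pos, fun ε hε => ?_⟩, fun hSk ε hε => ?_, fun hSk => ?_⟩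
  · have hS : S.card < n := by exact_mod_cast hSk.trans hkn
    refine RandomMonomialIdeal.aas_map _
      (((RandomMonomialIdeal.aas_Z_lt_ncard_standardPairs (K := K) S hkn hSk hp hε).inter
        (RandomMonomialIdeal.aas_ncard_standardPairs_lt (K := K) S hS hSk.le hp hε)).mono
          (Filter.Eventually.of_forall fun D B hB => ⟨hB.2.1, ?_, hB.2.2⟩))
    rw [one_mul]
    exact_mod_cast hB.1
  · have hS : S.card < n := by exact_mod_cast hSk.trans_lt hkn
    exact RandomMonomialIdeal.aas_map _
      (RandomMonomialIdeal.aas_ncard_standardPairs_lt (K := K) S hS hSk.le hp hε)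
  · exact RandomMonomialIdeal.aas_map _
      (RandomMonomialIdeal.aas_standardPairs_eq_empty (K := K) hn S hSk hp)
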